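/- Let $s>0$ and let $\mathcal P=\mathbb R[S_1,S_2,S_3]/(S_1^2+S_2^2+S_3^2-s^2)$ be the algebra of polynomials on the sphere of radius $s$, with the Poisson bracket $\{f,g\}=\sum_{i,j,k=1}^{3}\epsilon_{ijk}S_i\frac{\partial f}{\partial S_j}\frac{\partial g}{\partial S_k}$. Let $\mathcal P^1\subset\mathcal P$ be the Poisson subalgebra of elements of degree at most one (that is, having a representative of degree at most one), let $\mathcal O\subset\mathcal P$ be the Poisson subalgebra of odd polynomials (those with a representative all of whose terms have odd degree), and let $\tilde{\mathcal O}=\mathcal O\oplus\mathbb R\supset\mathcal P^1$. (A Poisson subalgebra is a real subspace closed under the Poisson bracket.) An admissible quantization of $(\tilde{\mathcal O},\mathcal P^1)$ is a real-linear map $\mathcal Q$ from $\tilde{\mathcal O}$ to the bounded self-adjoint operators on a complex Hilbert space $H$ such that $\mathcal Q(\{f,g\})=-\mathrm i\,[\mathcal Q(f),\mathcal Q(g)]$ for all $f,g\in\tilde{\mathcal O}$, $\mathcal Q(1)=I$, and $\mathcal Q(\mathcal P^1)$ acts irreducibly, that is, $H\neq 0$ and the only closed subspaces of $H$ invariant under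 all $\mathcal Q(f)$, $f\in\mathcal P^1$, are $0$ and $H$. If $\mathcal Q$ is an admissible quantization of $(\tilde{\mathcal O},\mathcal P^1)$, then there are real constants $a,c$ such that $$\mathcal Q(S_i^3)=a\,\mathcal Q(S_i)^3+c\,\mathcal Q(S_i)\qquad\text{for } i=1,2,3,$$ $$\mathcal Q(S_iS_\ell S_i)=a\,\mathcal Q(S_i)\mathcal Q(S_\ell)\mathcal Q(S_i)+\tfrac13(a+c)\,\mathcal Q(S_\ell)\qquad\text{for all } i\neq\ell,$$ $$\mathcal Q(S_1S_2S_3)=a\,\mathcal Q(S_1)\mathcal Q(S_2)\mathcal Q(S_3)+\frac{a}{2\mathrm i}\bigl(\mathcal Q(S_1)^2-\mathcal Q(S_2)^2+\mathcal Q(S_3)^2\bigr).$$ -/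

import Mathlib

namespace SpinSphere

open MvPolynomial

/-! ### Polynomials in the spin components on the sphere of radius `s` -/

/-- Real polynomials in the three indeterminates `S₁, S₂, S₃` (indexed by `0, 1, 2`). -/
abbrev Poly : Type := MvPolynomial (Fin 3) ℝ

/-- The bracket `{f, g} = ∑ ε_{ijk} S_i (∂f/∂S_j) (∂g/∂S_k)` of polynomials on `ℝ³`, with the sum
over the six nonzero values of the Levi-Civita symbol written out. -/
noncomputable def polyBracket (f g : Poly) : Poly :=
  X 0 * (pderiv 1 f * pderiv 2 g - pderiv 2 f * pderiv 1 g)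
    + X 1 * (pderiv 2 f * pderiv 0 g - pderiv 0 f * pderiv 2 g)
    + X 2 * (pderiv 0 f * pderiv 1 g - pderiv 1 f * pderiv 0 g)

/-- The ideal generated by `S₁² + S₂² + S₃² - s²`. -/
noncomputable def sphereIdeal (s : ℝ) : Ideal Poly :=
  Ideal.span {X 0 ^ 2 + X 1 ^ 2 + X 2 ^ 2 - C (s ^ 2)}

/-- The algebra `𝒫` of polynomials in the spin components modulo `S₁² + S₂² + S₃² = s²`. -/
abbrev SpherePoly (s : ℝ) : Type := Poly ⧸ sphereIdeal s

/-- The class in `𝒫` of a polynomial, as a real-linear map. -/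
noncomputable def toSphere (s : ℝ) : Poly →ₗ[ℝ] SpherePoly s :=
  (Ideal.Quotient.mkₐ ℝ (sphereIdeal s)).toLinearMap

/-- The spin component `S_i` as an element of `𝒫`. -/
noncomputable def spin (s : ℝ) (i : Fin 3) : SpherePoly s :=
  Ideal.Quotient.mk (sphereIdeal s) (X i)

theorem polyBracket_swap (f g : Poly) : polyBracket f g = -polyBracket g f := by
  unfold polyBracket; ring

theorem polyBracket_add_left (f g h : Poly) :
    polyBracket (f + g) h = polyBracket f h + polyBracket g h := by
  simp only [polyBracket, map_add]; ring

theorem polyBracket_add_right (f g h : Poly) :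
    polyBracket h (f + g) = polyBracket h f + polyBracket h g := by
  simp only [polyBracket, map_add]; ring

theorem polyBracket_C_left (r : ℝ) (g : Poly) : polyBracket (C r) g = 0 := by
  simp [polyBracket]

theorem polyBracket_C_right (r : ℝ) (g : Poly) : polyBracket g (C r) = 0 := by
  simp [polyBracket]

theorem polyBracket_mem_left (s : ℝ) {f : Poly} (hf : f ∈ sphereIdeal s) (g : Poly) :
    polyBracket f g ∈ sphereIdeal s := by
  obtain ⟨h, rfl⟩ := Ideal.mem_span_singleton'.1 hf
  refine Ideal.mem_span_singleton'.2 ⟨polyBracket h g, ?_⟩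
  have h01 : (0 : Fin 3) ≠ 1 := by decide
  have h02 : (0 : Fin 3) ≠ 2 := by decide
  have h12 : (1 : Fin 3) ≠ 2 := by decide
  simp only [polyBracket, Derivation.leibniz, Derivation.leibniz_pow, map_add, map_sub, pderiv_C,
    pderiv_X_self, pderiv_X_of_ne h01, pderiv_X_of_ne h02, pderiv_X_of_ne h12,
    pderiv_X_of_ne h01.symm, pderiv_X_of_ne h02.symm, pderiv_X_of_ne h12.symm, smul_eq_mul,
    nsmul_eq_mul]
  push_cast
  ring

theorem polyBracket_mem_right (s : ℝ) {f : Poly} (hf : f ∈ sphereIdeal s) (g : Poly) :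
    polyBracket g f ∈ sphereIdeal s := by
  rw [polyBracket_swap]
  exact neg_mem (polyBracket_mem_left s hf g)

theorem toSphere_polyBracket_congr (s : ℝ) {f f' g g' : Poly}
    (hf : toSphere s f = toSphere s f') (hg : toSphere s g = toSphere s g') :
    toSphere s (polyBracket f g) = toSphere s (polyBracket f' g') := by
  have hf' : f - f' ∈ sphereIdeal s := Ideal.Quotient.eq.1 hf
  have hg' : g - g' ∈ sphereIdeal s := Ideal.Quotient.eq.1 hg
  refine Ideal.Quotient.eq.2 ?_
  have e : polyBracket f g - polyBracket f' g'
      = polyBracket (f - f') g + polyBracket f' (g - g') := by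
    simp only [polyBracket, map_sub]; ring
  rw [e]
  exact add_mem (polyBracket_mem_left s hf' g) (polyBracket_mem_right s hg' f')

/-- The Poisson bracket on `𝒫`, induced by the bracket of representatives. -/
noncomputable def poissonBracket (s : ℝ) (p q : SpherePoly s) : SpherePoly s :=
  Quotient.liftOn₂ p q (fun f g => toSphere s (polyBracket f g))
    (fun _ _ _ _ hf hg => toSphere_polyBracket_congr s (Quotient.sound hf) (Quotient.sound hg))

theorem poissonBracket_toSphere (s : ℝ) (f g : Poly) :
    poissonBracket s (toSphere s f) (toSphere s g) = toSphere s (polyBracket f g) := rfl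

/-! ### Poisson subalgebras -/

/-- A Poisson subalgebra of `𝒫`: a real subspace closed under the Poisson bracket. -/
structure PoissonSubalgebra (s : ℝ) extends Submodule ℝ (SpherePoly s) where
  bracket_mem' : ∀ p q : SpherePoly s, p ∈ carrier → q ∈ carrier → poissonBracket s p q ∈ carrier

/-- The polynomials all of whose terms are of odd degree. -/
def oddPoly : Submodule ℝ Poly where
  carrier := {f | ∀ d : Fin 3 →₀ ℕ, coeff d f ≠ 0 → Odd d.degree}
  zero_mem' := fun d hd => absurd (coeff_zero d) hd
  add_mem' := by
    intro f g hf hg d hd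
    by_cases h : coeff d f = 0
    · refine hg d fun h' => hd ?_
      rw [coeff_add, h, h', add_zero]
    · exact hf d h
  smul_mem' := by
    intro r f hf d hd
    refine hf d fun h => hd ?_
    rw [coeff_smul, h, smul_zero]

/-- The subspace `𝒫ᵏ` of elements of `𝒫` with a representative of degree at most `k`. -/
noncomputable def degreeLE (s : ℝ) (k : ℕ) : Submodule ℝ (SpherePoly s) :=
  (restrictTotalDegree (Fin 3) ℝ k).map (toSphere s)

/-- The subspace `𝒪` of odd elements of `𝒫`. -/
noncomputable def oddPart (s : ℝ) : Submodule ℝ (SpherePoly s) :=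
  oddPoly.map (toSphere s)

/-- The subspace `𝒪 + ℝ` of `𝒫`. -/
noncomputable def oddPlusConstSubmodule (s : ℝ) : Submodule ℝ (SpherePoly s) :=
  oddPart s ⊔ Submodule.span ℝ {1}

theorem mem_oddPoly_iff (f : Poly) :
    f ∈ oddPoly ↔ IsWeightedHomogeneous (fun _ : Fin 3 => (1 : ZMod 2)) f 1 := by
  have key : ∀ d : Fin 3 →₀ ℕ,
      Finsupp.weight (fun _ : Fin 3 => (1 : ZMod 2)) d = (d.degree : ZMod 2) := by
    intro d
    rw [Finsupp.weight_apply, Finsupp.degree_eq_sum, Finsupp.sum_fintype _ _ (by simp)]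
    simp
  constructor
  · intro hf d hd
    rw [key]
    exact (ZMod.natCast_eq_one_iff_odd).2 (hf d hd)
  · intro hf d hd
    have := hf hd
    rw [key] at this
    exact (ZMod.natCast_eq_one_iff_odd).1 this

theorem polyBracket_mem_oddPoly {f g : Poly} (hf : f ∈ oddPoly) (hg : g ∈ oddPoly) :
    polyBracket f g ∈ oddPoly := by
  rw [mem_oddPoly_iff] at *
  have hd : ∀ {h : Poly} (i : Fin 3),
      IsWeightedHomogeneous (fun _ : Fin 3 => (1 : ZMod 2)) h 1 →
      IsWeightedHomogeneous (fun _ : Fin 3 => (1 : ZMod 2)) (pderiv i h) 0 :=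
    fun i hh => hh.pderiv (by simp)
  have hm : ∀ i j k : Fin 3, IsWeightedHomogeneous (fun _ : Fin 3 => (1 : ZMod 2))
      (X i * (pderiv j f * pderiv k g - pderiv k f * pderiv j g)) 1 := by
    intro i j k
    have h1 := ((hd j hf).mul (hd k hg)).sub ((hd k hf).mul (hd j hg))
    have h2 := (isWeightedHomogeneous_X ℝ (fun _ : Fin 3 => (1 : ZMod 2)) i).mul h1
    simpa using h2
  exact ((hm 0 1 2).add (hm 1 2 0)).add (hm 2 0 1)

theorem mem_oddPlusConst_iff (s : ℝ) (p : SpherePoly s) :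
    p ∈ oddPlusConstSubmodule s ↔ ∃ f ∈ oddPoly, ∃ r : ℝ, toSphere s (f + C r) = p := by
  have hC : ∀ r : ℝ, toSphere s (C r) = r • (1 : SpherePoly s) := by
    intro r
    rw [show (C r : Poly) = r • 1 by rw [smul_eq_C_mul, mul_one], map_smul]
    rfl
  simp only [oddPlusConstSubmodule, Submodule.mem_sup, oddPart, Submodule.mem_map,
    Submodule.mem_span_singleton, map_add, hC]
  constructor
  · rintro ⟨_, ⟨f, hf, rfl⟩, _, ⟨r, rfl⟩, h⟩
    exact ⟨f, hf, r, h⟩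
  · rintro ⟨f, hf, r, h⟩
    exact ⟨_, ⟨f, hf, rfl⟩, _, ⟨r, rfl⟩, h⟩

/-- The Poisson subalgebra `𝒪̃ = 𝒪 ⊕ ℝ` of `𝒫`. -/
noncomputable def oddPlusConst (s : ℝ) : PoissonSubalgebra s where
  toSubmodule := oddPlusConstSubmodule s
  bracket_mem' := by
    intro p q hp hq
    obtain ⟨f, hf, r, rfl⟩ := (mem_oddPlusConst_iff s p).1 hp
    obtain ⟨g, hg, t, rfl⟩ := (mem_oddPlusConst_iff s q).1 hq
    refine (mem_oddPlusConst_iff s _).2 ⟨_, polyBracket_mem_oddPoly hf hg, 0, ?_⟩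
    rw [poissonBracket_toSphere]
    simp [polyBracket_add_left, polyBracket_add_right, polyBracket_C_left, polyBracket_C_right]

theorem eq_of_totalDegree_le_one {f : Poly} (hf : f.totalDegree ≤ 1) :
    f = ∑ i, coeff (Finsupp.single i 1) f • X i + C (coeff 0 f) := by
  ext d
  rw [coeff_add, coeff_sum]
  simp only [coeff_smul, coeff_X, coeff_C, smul_eq_mul]
  rcases Nat.lt_or_ge d.degree 2 with hd | hd
  · rcases Nat.lt_or_ge d.degree 1 with h0 | h0
    · have : d = 0 := by
        rw [← Finsupp.degree_eq_zero_iff]; omega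
      subst this
      simp
    · have h1 : d.degree = 1 := by omega
      obtain ⟨i, rfl⟩ := (Finsupp.sum_eq_one_iff d).1 h1
      have : (0 : Fin 3 →₀ ℕ) ≠ Finsupp.single i 1 := by
        intro h; rw [← h] at h1; simp at h1
      simp [this, Finsupp.single_left_inj, Finset.sum_ite_eq']
  · have h0 : coeff d f = 0 := by
      by_contra h
      have := le_totalDegree (mem_support_iff.2 h)
      rw [Finsupp.degree_eq_sum] at hd
      rw [Finsupp.sum_fintype _ _ (by simp)] at this
      omega
    have h1 : (0 : Fin 3 →₀ ℕ) ≠ d := by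
      rintro rfl; simp at hd
    have h2 : ∀ i : Fin 3, Finsupp.single i 1 ≠ d := by
      rintro i rfl; simp at hd
    simp [h0, h1, h2]

/-- The Poisson subalgebra `𝒫¹` of `𝒫`. -/
noncomputable def degreeLEOne (s : ℝ) : PoissonSubalgebra s where
  toSubmodule := degreeLE s 1
  bracket_mem' := by
    rintro _ _ ⟨f, hf, rfl⟩ ⟨g, hg, rfl⟩
    refine ⟨polyBracket f g, ?_, (poissonBracket_toSphere s f g).symm⟩
    have hf' := eq_of_totalDegree_le_one ((mem_restrictTotalDegree _ _ _).1 hf)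
    have hg' := eq_of_totalDegree_le_one ((mem_restrictTotalDegree _ _ _).1 hg)
    have hX : ∀ (h : Poly) (_ : h = ∑ i, coeff (Finsupp.single i 1) h • X i + C (coeff 0 h))
        (i : Fin 3), pderiv i h = C (coeff (Finsupp.single i 1) h) := by
      intro h hh i
      conv_lhs => rw [hh]
      rw [map_add, map_sum, pderiv_C, add_zero, Finset.sum_eq_single i]
      · rw [Derivation.map_smul, pderiv_X_self, smul_eq_C_mul, mul_one]
      · intro j _ hj
        rw [Derivation.map_smul, pderiv_X_of_ne hj, smul_zero]
      · simp
    have hm : ∀ i j k : Fin 3, X i * (pderiv j f * pderiv k g - pderiv k f * pderiv j g)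
        ∈ restrictTotalDegree (Fin 3) ℝ 1 := by
      intro i j k
      rw [hX f hf', hX f hf', hX g hg', hX g hg', ← C_mul, ← C_mul, ← C_sub, mul_comm,
        ← smul_eq_C_mul]
      refine Submodule.smul_mem _ _ ((mem_restrictTotalDegree _ _ _).2 ?_)
      rw [totalDegree_X]
    exact add_mem (add_mem (hm 0 1 2) (hm 1 2 0)) (hm 2 0 1)

theorem X_mem_oddPoly (i : Fin 3) : (X i : Poly) ∈ oddPoly :=
  (mem_oddPoly_iff _).2 (isWeightedHomogeneous_X ℝ _ i)

theorem degreeLEOne_le (s : ℝ) : (degreeLEOne s).toSubmodule ≤ (oddPlusConst s).toSubmodule := by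
  rintro _ ⟨f, hf, rfl⟩
  have hf' := eq_of_totalDegree_le_one ((mem_restrictTotalDegree _ _ _).1 hf)
  refine (mem_oddPlusConst_iff s _).2
    ⟨_, ?_, coeff 0 f, congrArg (toSphere s) hf'.symm⟩
  exact Submodule.sum_mem _ fun i _ => Submodule.smul_mem _ _ (X_mem_oddPoly i)

theorem spin_mem (s : ℝ) (i : Fin 3) : spin s i ∈ (oddPlusConst s).toSubmodule :=
  (mem_oddPlusConst_iff s _).2 ⟨X i, X_mem_oddPoly i, 0, by rw [C_0, add_zero]; rfl⟩

theorem spin_mul_mem (s : ℝ) (i j k : Fin 3) :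
    spin s i * spin s j * spin s k ∈ (oddPlusConst s).toSubmodule := by
  refine (mem_oddPlusConst_iff s _).2 ⟨X i * X j * X k, ?_, 0, by rw [C_0, add_zero]; rfl⟩
  rw [mem_oddPoly_iff]
  have h := fun i => isWeightedHomogeneous_X ℝ (fun _ : Fin 3 => (1 : ZMod 2)) i
  have e : (1 : ZMod 2) + 1 + 1 = 1 := by decide
  simpa [e] using ((h i).mul (h j)).mul (h k)

theorem spin_pow_three_mem (s : ℝ) (i : Fin 3) :
    spin s i ^ 3 ∈ (oddPlusConst s).toSubmodule := by
  rw [pow_three']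
  exact spin_mul_mem s i i i

/-! ### Quantizations -/

section Quantization

variable {s : ℝ} {H : Type*} [NormedAddCommGroup H] [InnerProductSpace ℂ H] [CompleteSpace H]

/-- A quantization of a Poisson subalgebra `𝒞` on the Hilbert space `H`: a real-linear map into the
self-adjoint operators that takes Poisson brackets to `-i` times commutators and, if `1 ∈ 𝒞`,
takes `1` to the identity. -/
structure IsQuantization (𝒞 : PoissonSubalgebra s) (Q : 𝒞.toSubmodule →ₗ[ℝ] (H →L[ℂ] H)) :
    Prop where
  selfAdjoint : ∀ p, IsSelfAdjoint (Q p)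
  bracket : ∀ p q : 𝒞.toSubmodule,
    Q ⟨poissonBracket s p q, 𝒞.bracket_mem' p q p.2 q.2⟩ = -Complex.I • (Q p * Q q - Q q * Q p)
  one : ∀ h : (1 : SpherePoly s) ∈ 𝒞.toSubmodule, Q ⟨1, h⟩ = 1

/-- A set of operators on `H` is irreducible if `H ≠ 0` and the only closed subspaces invariant
under all of them are `0` and `H`. -/
def IsIrreducibleSet (A : Set (H →L[ℂ] H)) : Prop :=
  Nontrivial H ∧ ∀ W : Submodule ℂ H, IsClosed (W : Set H) →
    (∀ T ∈ A, ∀ x ∈ W, T x ∈ W) → W = ⊥ ∨ W = ⊤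

/-- An admissible quantization of the pair `(𝒞, ℬ)`: a quantization of `𝒞` that is irreducible
on `ℬ ⊆ 𝒞`. -/
structure IsAdmissibleQuantization (𝒞 ℬ : PoissonSubalgebra s)
    (hle : ℬ.toSubmodule ≤ 𝒞.toSubmodule) (Q : 𝒞.toSubmodule →ₗ[ℝ] (H →L[ℂ] H)) : Prop
    extends IsQuantization 𝒞 Q where
  irreducible : IsIrreducibleSet (Set.range fun p : ℬ.toSubmodule => Q ⟨p, hle p.2⟩)

end Quantization

end SpinSphere

namespace SpinSphere

section LadderAlgebra

variable {A : Type*} [Ring A] [Algebra ℂ A]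

theorem mul_pow_of_commutator {h x : A} {t : ℂ} (hx : h * x = x * h + t • x) (n : ℕ) :
    h * x ^ n = x ^ n * h + (n * t) • x ^ n := by
  induction n with
  | zero => simp
  | succ n ih =>
    rw [pow_succ, ← mul_assoc, ih, add_mul, mul_assoc, hx, mul_add, smul_mul_assoc, mul_smul_comm,
      ← mul_assoc]
    push_cast
    module

theorem lower_mul_raise_pow {h e f : A} (he : h * e = e * h + e) (hef : f * e = e * f - 2 * h)
    (n : ℕ) :
    f * e ^ (n + 1) = e ^ (n + 1) * f - ((n : ℂ) + 1) • (e ^ n * (2 * h + (n : ℂ) • 1)) := by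
  induction n with
  | zero => simp [hef]
  | succ n ih =>
    have h1 : h * e ^ (n + 1) = e ^ (n + 1) * h + ((n : ℂ) + 1) • e ^ (n + 1) := by
      have := mul_pow_of_commutator (h := h) (x := e) (t := 1) (by rw [one_smul]; exact he) (n + 1)
      simpa using this
    have h2 : f * e ^ (n + 2) = e * (f * e ^ (n + 1)) - 2 * (h * e ^ (n + 1)) := by
      rw [pow_succ' e (n + 1), ← mul_assoc, hef]; noncomm_ring
    have h3 : e * (e ^ (n + 1) * f) = e ^ (n + 2) * f := by rw [pow_succ' e (n + 1), mul_assoc]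
    have h4 : e * (e ^ n * (2 * h + (n : ℂ) • 1)) = e ^ (n + 1) * (2 * h + (n : ℂ) • 1) := by
      rw [pow_succ' e n, mul_assoc]
    rw [h2, ih, h1, mul_sub, mul_smul_comm, h3, h4]
    simp only [two_mul, mul_add, mul_smul_comm, mul_one]
    push_cast
    module

end LadderAlgebra

theorem exists_pow_eq_zero_of_commutator {A : Type*} [NormedRing A] [NormedAlgebra ℂ A] {h x : A}
    {t : ℂ} (ht : ‖t‖ = 1) (hx : h * x = x * h + t • x) : ∃ N : ℕ, x ^ N = 0 := by
  obtain ⟨N, hN⟩ := exists_nat_gt (2 * ‖h‖)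
  refine ⟨N, ?_⟩
  by_contra hne
  have hpos : 0 < ‖x ^ N‖ := norm_pos_iff.2 hne
  have h1 : (N * t) • x ^ N = h * x ^ N - x ^ N * h := by
    rw [mul_pow_of_commutator hx N]; abel
  have h2 : (N : ℝ) * ‖x ^ N‖ = ‖h * x ^ N - x ^ N * h‖ := by
    rw [← h1, norm_smul, norm_mul, ht]; simp
  have h3 : ‖h * x ^ N - x ^ N * h‖ ≤ ‖h‖ * ‖x ^ N‖ + ‖x ^ N‖ * ‖h‖ :=
    (norm_sub_le _ _).trans (add_le_add (norm_mul_le _ _) (norm_mul_le _ _))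
  nlinarith

section Ladder

variable {H : Type*} [NormedAddCommGroup H] [InnerProductSpace ℂ H]
  {h e f : H →L[ℂ] H}

theorem exists_ne_zero_apply_eq_zero [Nontrivial H] {N : ℕ} (hN : f ^ N = 0) :
    ∃ w : H, w ≠ 0 ∧ f w = 0 := by
  by_contra! hcon
  have hinj : ∀ n : ℕ, ∀ w : H, w ≠ 0 → (f ^ n) w ≠ 0 := by
    intro n
    induction n with
    | zero => intro w hw; simpa using hw
    | succ n ih => intro w hw; rw [pow_succ]; exact ih _ (hcon w hw)
  obtain ⟨w, hw⟩ := exists_ne (0 : H)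
  exact hinj N w hw (by simp [hN])

theorem exists_lowest_weight_of_pow_apply_eq_zero (he : h * e = e * h + e)
    (hf : h * f = f * h - f) (hef : f * e = e * f - 2 * h) (n : ℕ) :
    ∀ w : H, w ≠ 0 → f w = 0 → (e ^ n) w = 0 →
      ∃ (u : H) (μ : ℂ), u ≠ 0 ∧ f u = 0 ∧ h u = μ • u := by
  induction n with
  | zero => intro w hw _ h0; exact absurd (by simpa using h0) hw
  | succ n ih =>
    intro w hw hfw hew
    have hw' := congrArg (fun T : H →L[ℂ] H => T w) (lower_mul_raise_pow he hef n)
    simp only [mul_apply_eq_comp, sub_apply,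
      smul_apply, hew, hfw, map_zero, zero_sub] at hw'
    have h0 : (e ^ n) ((2 * h + (n : ℂ) • 1 : H →L[ℂ] H) w) = 0 := by
      have := neg_eq_zero.1 hw'.symm
      rcases smul_eq_zero.1 this with h' | h'
      · exact absurd h' (by exact_mod_cast Nat.succ_ne_zero n)
      · exact h'
    have e2 : (2 * h + (n : ℂ) • 1 : H →L[ℂ] H) w = (2 : ℂ) • h w + (n : ℂ) • w := by
      simp [two_mul, two_smul]
    rw [e2] at h0
    by_cases hz : (2 : ℂ) • h w + (n : ℂ) • w = 0
    · refine ⟨w, -(n / 2 : ℂ), hw, hfw, ?_⟩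
      have : h w = (1 / 2 : ℂ) • ((2 : ℂ) • h w + (n : ℂ) • w) - (n / 2 : ℂ) • w := by module
      rw [this, hz]; simp
    · refine ih _ hz ?_ h0
      have := congrArg (fun T : H →L[ℂ] H => T w) hf
      simp only [mul_apply_eq_comp, sub_apply, hfw, map_zero,
        sub_zero] at this
      simp [hfw, ← this]

theorem span_ladder_eq_top (he : h * e = e * h + e) (hef : f * e = e * f - 2 * h)
    (hirr : ∀ W : Submodule ℂ H, IsClosed (W : Set H) → (∀ x ∈ W, h x ∈ W) → (∀ x ∈ W, e x ∈ W) →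
      (∀ x ∈ W, f x ∈ W) → W = ⊥ ∨ W = ⊤)
    {N : ℕ} (hN : e ^ N = 0) {u : H} {μ : ℂ} (hu : u ≠ 0) (hfu : f u = 0) (hhu : h u = μ • u) :
    Submodule.span ℂ (Set.range fun k : ℕ => (e ^ k) u) = ⊤ := by
  have hhk : ∀ k : ℕ, h ((e ^ k) u) = (μ + k) • (e ^ k) u := by
    intro k
    have := congrArg (fun T : H →L[ℂ] H => T u)
      (mul_pow_of_commutator (t := 1) (by rw [one_smul]; exact he) k)
    simp only [mul_apply_eq_comp, add_apply,
      smul_apply, hhu, map_smul, mul_one] at this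
    rw [this, add_smul]
  have hinv : ∀ T : H →L[ℂ] H, (∀ k : ℕ, T ((e ^ k) u) ∈
      Submodule.span ℂ (Set.range fun k : ℕ => (e ^ k) u)) →
      ∀ x ∈ Submodule.span ℂ (Set.range fun k : ℕ => (e ^ k) u),
        T x ∈ Submodule.span ℂ (Set.range fun k : ℕ => (e ^ k) u) := by
    intro T hT x hx
    have : Submodule.span ℂ (Set.range fun k : ℕ => (e ^ k) u) ≤
        (Submodule.span ℂ (Set.range fun k : ℕ => (e ^ k) u)).comap T.toLinearMap :=
      Submodule.span_le.2 (by rintro _ ⟨k, rfl⟩; exact hT k)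
    exact this hx
  have hmem : ∀ k : ℕ, (e ^ k) u ∈ Submodule.span ℂ (Set.range fun k : ℕ => (e ^ k) u) :=
    fun k => Submodule.subset_span ⟨k, rfl⟩
  have hfin : FiniteDimensional ℂ (Submodule.span ℂ (Set.range fun k : ℕ => (e ^ k) u)) := by
    refine FiniteDimensional.span_of_finite ℂ
      (((Set.finite_lt_nat N).image fun k => (e ^ k) u).union (Set.finite_singleton 0) |>.subset ?_)
    rintro _ ⟨k, rfl⟩
    by_cases hk : k < N
    · exact Or.inl ⟨k, hk, rfl⟩
    · right
      simp only [Set.mem_singleton_iff]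
      rw [pow_eq_zero_of_le (not_lt.1 hk) hN]; rfl
  have hne : Submodule.span ℂ (Set.range fun k : ℕ => (e ^ k) u) ≠ ⊥ := fun hb =>
    hu (by simpa using (Submodule.mem_bot ℂ).1 (hb ▸ hmem 0))
  refine (hirr _ (Submodule.closed_of_finiteDimensional _) (hinv h ?_) (hinv e ?_)
    (hinv f ?_)).resolve_left hne
  · intro k
    rw [hhk]; exact Submodule.smul_mem _ _ (hmem k)
  · intro k
    have : e ((e ^ k) u) = (e ^ (k + 1)) u := by rw [pow_succ']; rfl
    rw [this]; exact hmem _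
  · intro k
    cases k with
    | zero => simp [hfu]
    | succ k =>
      have := congrArg (fun T : H →L[ℂ] H => T u) (lower_mul_raise_pow he hef k)
      simp only [mul_apply_eq_comp, sub_apply,
        smul_apply, hfu, map_zero, zero_sub] at this
      have e2 : (2 * h + (k : ℂ) • 1 : H →L[ℂ] H) u = (2 * μ + k) • u := by
        simp [two_mul, hhu, add_smul]
      rw [this, e2, map_smul]
      exact neg_mem (Submodule.smul_mem _ _ (Submodule.smul_mem _ _ (hmem k)))

theorem eq_smul_pow_of_span_ladder_eq_top (he : h * e = e * h + e) {N : ℕ} (hN : e ^ N = 0) {u : H}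
    {μ : ℂ} (hhu : h u = μ • u)
    (htop : Submodule.span ℂ (Set.range fun k : ℕ => (e ^ k) u) = ⊤) {Y : H →L[ℂ] H} {m : ℕ}
    (hY : h * Y = Y * h + (m : ℂ) • Y) (heY : e * Y = Y * e) : ∃ a : ℂ, Y = a • e ^ m := by
  have hhk : ∀ k : ℕ, h ((e ^ k) u) = (μ + k) • (e ^ k) u := by
    intro k
    have := congrArg (fun T : H →L[ℂ] H => T u)
      (mul_pow_of_commutator (t := 1) (by rw [one_smul]; exact he) k)
    simp only [mul_apply_eq_comp, add_apply,
      smul_apply, hhu, map_smul, mul_one] at this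
    rw [this, add_smul]
  have hYu : h (Y u) = (μ + m) • Y u := by
    have := congrArg (fun T : H →L[ℂ] H => T u) hY
    simp only [mul_apply_eq_comp, add_apply,
      smul_apply, hhu, map_smul] at this
    rw [this, add_smul]
  have hprod : ∀ S : Finset ℕ, ∃ P : H →L[ℂ] H, ∀ (x : H) (ν : ℂ), h x = ν • x →
      P x = (∏ k ∈ S, (ν - (μ + k))) • x := by
    intro S
    induction S using Finset.induction_on with
    | empty => exact ⟨1, by simp⟩
    | insert i S hi ih =>
      obtain ⟨P, hP⟩ := ih
      refine ⟨(h - (μ + i) • (1 : H →L[ℂ] H)) * P, fun x ν hx => ?_⟩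
      rw [mul_apply_eq_comp, hP x ν hx, Finset.prod_insert hi, map_smul, sub_apply, smul_apply,
        one_apply_eq_self, hx]
      module
  set S := (Finset.range N).erase m with hS
  obtain ⟨P, hP⟩ := hprod S
  have hPmem : ∀ x : H, P x ∈ Submodule.span ℂ {(e ^ m) u} := by
    have : (⊤ : Submodule ℂ H) ≤ (Submodule.span ℂ {(e ^ m) u}).comap P.toLinearMap := by
      rw [← htop, Submodule.span_le]
      rintro _ ⟨k, rfl⟩
      change P ((e ^ k) u) ∈ Submodule.span ℂ {(e ^ m) u}
      rw [hP _ _ (hhk k)]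
      by_cases hk : k = m
      · subst hk
        exact Submodule.smul_mem _ _ (Submodule.mem_span_singleton_self _)
      by_cases hkN : k < N
      · rw [Finset.prod_eq_zero (i := k) (by simp [hS, hk, hkN]) (by simp)]
        simp
      · rw [pow_eq_zero_of_le (not_lt.1 hkN) hN]; simp
    exact fun x => this Submodule.mem_top
  have hne : (∏ k ∈ S, ((μ + m) - (μ + k)) : ℂ) ≠ 0 := by
    refine Finset.prod_ne_zero_iff.2 fun k hk => ?_
    have : m ≠ k := fun h' => (Finset.mem_erase.1 hk).1 h'.symm
    rw [add_sub_add_left_eq_sub, sub_ne_zero]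
    exact_mod_cast this
  have hYmem : Y u ∈ Submodule.span ℂ {(e ^ m) u} := by
    have := hPmem (Y u)
    rw [hP _ _ hYu] at this
    exact (Submodule.smul_mem_iff _ hne).1 this
  obtain ⟨a, ha⟩ := Submodule.mem_span_singleton.1 hYmem
  refine ⟨a, ContinuousLinearMap.coe_injective (LinearMap.ext_on_range htop fun k => ?_)⟩
  have hc : Commute Y (e ^ k) := Commute.pow_right heY.symm k
  have h1 : Y ((e ^ k) u) = (e ^ k) (Y u) := congrArg (fun T : H →L[ℂ] H => T u) hc.eq
  have h2 : (e ^ m) ((e ^ k) u) = (e ^ k) ((e ^ m) u) :=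
    congrArg (fun T : H →L[ℂ] H => T u) (Commute.pow_pow_self e m k).eq
  change Y ((e ^ k) u) = a • (e ^ m) ((e ^ k) u)
  rw [h1, ← ha, h2, map_smul]

/-- In an irreducible bounded representation of `𝔰𝔩₂`, the operators of weight `m` that commute
with the raising operator `e` are the multiples of `e ^ m`. -/
theorem exists_eq_smul_pow_of_irreducible [Nontrivial H] (he : h * e = e * h + e)
    (hf : h * f = f * h - f) (hef : f * e = e * f - 2 * h)
    (hirr : ∀ W : Submodule ℂ H, IsClosed (W : Set H) → (∀ x ∈ W, h x ∈ W) → (∀ x ∈ W, e x ∈ W) →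
      (∀ x ∈ W, f x ∈ W) → W = ⊥ ∨ W = ⊤)
    {Y : H →L[ℂ] H} {m : ℕ} (hY : h * Y = Y * h + (m : ℂ) • Y) (heY : e * Y = Y * e) :
    ∃ a : ℂ, Y = a • e ^ m := by
  obtain ⟨N, hN⟩ := exists_pow_eq_zero_of_commutator (h := h) (x := e) (t := 1) (by simp)
    (by rw [one_smul]; exact he)
  obtain ⟨M, hM⟩ := exists_pow_eq_zero_of_commutator (h := h) (x := f) (t := -1) (by simp)
    (by rw [hf]; module)
  obtain ⟨w, hw, hfw⟩ := exists_ne_zero_apply_eq_zero hM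
  obtain ⟨u, μ, hu, hfu, hhu⟩ := exists_lowest_weight_of_pow_apply_eq_zero he hf hef N w hw hfw
    (by rw [hN]; rfl)
  exact eq_smul_pow_of_span_ladder_eq_top he hN hhu
    (span_ladder_eq_top he hef hirr hN hu hfu hhu) hY heY

end Ladder

section Identities

variable {A : Type*} [Ring A] [Algebra ℂ A]

/-- Lowering `e ^ 3` three times gives the zonal cubic in `h`. -/
theorem lower_three_raise_pow_three {h e f : A} {κ : ℂ} (he : h * e = e * h + e)
    (hf : h * f = f * h - f) (hef : f * e = e * f - 2 * h)
    (hκ : e * f = κ • 1 - h * h + h) :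
    ⁅f, ⁅f, ⁅f, e ^ 3⁆⁆⁆ = (-120 : ℂ) • h ^ 3 + (72 * κ - 24) • h := by
  have r1 : e * h = h * e - e := by rw [he]; abel
  have r2 : f * h = h * f + f := by rw [hf]; abel
  have r3 : f * e = κ • 1 - h * h - h := by rw [hef, hκ, two_mul]; abel
  have r1' : ∀ x, e * (h * x) = h * (e * x) - e * x := fun x => by
    rw [← mul_assoc, r1, sub_mul, mul_assoc]
  have r2' : ∀ x, f * (h * x) = h * (f * x) + f * x := fun x => by
    rw [← mul_assoc, r2, add_mul, mul_assoc]
  have r3' : ∀ x, f * (e * x) = κ • x - h * (h * x) - h * x := fun x => by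
    rw [← mul_assoc, r3]; simp [sub_mul, mul_assoc]
  simp only [Ring.lie_def, pow_three, mul_sub, sub_mul, mul_add, add_mul, mul_assoc, r1, r3, hκ,
    r1', r2', r3', mul_smul_comm, smul_mul_assoc, mul_one]
  module

end Identities

section Hilbert

variable {H : Type*} [NormedAddCommGroup H] [InnerProductSpace ℂ H] {h e f : H →L[ℂ] H}

theorem exists_casimir_of_irreducible [Nontrivial H] (he : h * e = e * h + e)
    (hf : h * f = f * h - f) (hef : f * e = e * f - 2 * h)
    (hirr : ∀ W : Submodule ℂ H, IsClosed (W : Set H) → (∀ x ∈ W, h x ∈ W) → (∀ x ∈ W, e x ∈ W) →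
      (∀ x ∈ W, f x ∈ W) → W = ⊥ ∨ W = ⊤) :
    ∃ κ : ℂ, e * f = κ • 1 - h * h + h := by
  have r1 : e * h = h * e - e := by rw [he]; abel
  have r2 : f * h = h * f + f := by rw [hf]; abel
  have r1' : ∀ x, e * (h * x) = h * (e * x) - e * x := fun x => by
    rw [← mul_assoc, r1, sub_mul, mul_assoc]
  obtain ⟨κ, hκ⟩ := exists_eq_smul_pow_of_irreducible he hf hef hirr (m := 0)
    (Y := e * f + h * h - h)
    (by simp only [mul_sub, sub_mul, mul_add, add_mul, mul_assoc, r1', r2]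
        simp)
    (by simp only [mul_sub, sub_mul, mul_add, add_mul, mul_assoc, r1, r1', hef, two_mul]
        abel)
  refine ⟨κ, ?_⟩
  rw [pow_zero] at hκ
  rw [← hκ]; abel

end Hilbert

section Quantum

/-- A quantization of `𝒪̃` lifts to a linear map on all polynomials. -/
theorem IsQuantization.exists_linear_lift {s : ℝ} {H : Type*} [NormedAddCommGroup H] [InnerProductSpace ℂ H]
    [CompleteSpace H] (Q : (oddPlusConst s).toSubmodule →ₗ[ℝ] (H →L[ℂ] H))
    (hQ : IsQuantization (oddPlusConst s) Q) :
    ∃ q : Poly →ₗ[ℝ] (H →L[ℂ] H),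
      (∀ (f : Poly) (hf : toSphere s f ∈ (oddPlusConst s).toSubmodule), q f = Q ⟨_, hf⟩) ∧
      (∀ f ∈ sphereIdeal s, q f = 0) ∧
      ∀ f ∈ oddPoly, ∀ g ∈ oddPoly,
        ⁅q f, q g⁆ = Complex.I • q (polyBracket f g) := by
  obtain ⟨L, hL⟩ := LinearMap.exists_extend Q
  have hL' : ∀ p : (oddPlusConst s).toSubmodule, L p = Q p := fun p =>
    congrArg (fun T : (oddPlusConst s).toSubmodule →ₗ[ℝ] (H →L[ℂ] H) => T p) hL
  have hodd : ∀ f ∈ oddPoly, toSphere s f ∈ (oddPlusConst s).toSubmodule := fun f hf =>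
    (mem_oddPlusConst_iff s _).2 ⟨f, hf, 0, by rw [MvPolynomial.C_0, add_zero]⟩
  refine ⟨L ∘ₗ toSphere s, fun f hf => hL' ⟨_, hf⟩, fun f hf => ?_, fun f hf g hg => ?_⟩
  · have : toSphere s f = 0 := Ideal.Quotient.eq_zero_iff_mem.2 hf
    rw [LinearMap.comp_apply, this, map_zero]
  · have h1 := hQ.bracket ⟨_, hodd f hf⟩ ⟨_, hodd g hg⟩
    have h2 := hL' ⟨_, (oddPlusConst s).bracket_mem' _ _ (hodd f hf) (hodd g hg)⟩
    rw [h1] at h2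
    change ⁅L (toSphere s f), L (toSphere s g)⁆ = Complex.I • L (toSphere s (polyBracket f g))
    rw [← poissonBracket_toSphere]
    rw [h2, ← hL', ← hL', smul_smul, Ring.lie_def]
    simp

end Quantum

open MvPolynomial

/-- The monomial `S₁ᵃ S₂ᵇ S₃ᶜ`. -/
noncomputable def spinMonomial (a b c : ℕ) : Poly := X 0 ^ a * X 1 ^ b * X 2 ^ c

theorem spinMonomial_mem_oddPoly {a b c : ℕ} (h : Odd (a + b + c)) :
    spinMonomial a b c ∈ oddPoly := by
  rw [mem_oddPoly_iff]
  have hX := fun i => isWeightedHomogeneous_X ℝ (fun _ : Fin 3 => (1 : ZMod 2)) i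
  have := (((hX 0).pow a).mul ((hX 1).pow b)).mul ((hX 2).pow c)
  have e : a • (1 : ZMod 2) + b • 1 + c • 1 = 1 := by
    simp only [nsmul_eq_mul, mul_one]
    exact_mod_cast (ZMod.natCast_eq_one_iff_odd).2 h
  rwa [e] at this

theorem polyBracket_X_zero (a b c : ℕ) : polyBracket (X 0) (spinMonomial a b c)
    = (b : ℝ) • spinMonomial a (b - 1) (c + 1) - (c : ℝ) • spinMonomial a (b + 1) (c - 1) := by
  have h01 : (0 : Fin 3) ≠ 1 := by decide
  have h02 : (0 : Fin 3) ≠ 2 := by decide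
  have h12 : (1 : Fin 3) ≠ 2 := by decide
  simp only [polyBracket, spinMonomial, Derivation.leibniz, Derivation.leibniz_pow,
    pderiv_X_self, pderiv_X_of_ne h01, pderiv_X_of_ne h02, pderiv_X_of_ne h12,
    pderiv_X_of_ne h01.symm, pderiv_X_of_ne h02.symm, pderiv_X_of_ne h12.symm, smul_eq_mul,
    nsmul_eq_mul, smul_eq_C_mul, map_natCast]
  ring

theorem polyBracket_X_one (a b c : ℕ) : polyBracket (X 1) (spinMonomial a b c)
    = (c : ℝ) • spinMonomial (a + 1) b (c - 1) - (a : ℝ) • spinMonomial (a - 1) b (c + 1) := by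
  have h01 : (0 : Fin 3) ≠ 1 := by decide
  have h02 : (0 : Fin 3) ≠ 2 := by decide
  have h12 : (1 : Fin 3) ≠ 2 := by decide
  simp only [polyBracket, spinMonomial, Derivation.leibniz, Derivation.leibniz_pow,
    pderiv_X_self, pderiv_X_of_ne h01, pderiv_X_of_ne h02, pderiv_X_of_ne h12,
    pderiv_X_of_ne h01.symm, pderiv_X_of_ne h02.symm, pderiv_X_of_ne h12.symm, smul_eq_mul,
    nsmul_eq_mul, smul_eq_C_mul, map_natCast]
  ring

theorem polyBracket_X_two (a b c : ℕ) : polyBracket (X 2) (spinMonomial a b c)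
    = (a : ℝ) • spinMonomial (a - 1) (b + 1) c - (b : ℝ) • spinMonomial (a + 1) (b - 1) c := by
  have h01 : (0 : Fin 3) ≠ 1 := by decide
  have h02 : (0 : Fin 3) ≠ 2 := by decide
  have h12 : (1 : Fin 3) ≠ 2 := by decide
  simp only [polyBracket, spinMonomial, Derivation.leibniz, Derivation.leibniz_pow,
    pderiv_X_self, pderiv_X_of_ne h01, pderiv_X_of_ne h02, pderiv_X_of_ne h12,
    pderiv_X_of_ne h01.symm, pderiv_X_of_ne h02.symm, pderiv_X_of_ne h12.symm, smul_eq_mul,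
    nsmul_eq_mul, smul_eq_C_mul, map_natCast]
  ring

section SpinAlgebra

variable {A : Type*} [Ring A] [Algebra ℂ A] {x y z : A} {ι : ℂ}

theorem lie_swap_smul (hxy : ⁅x, y⁆ = ι • z) : ⁅y, x⁆ = (-ι) • z := by
  rw [neg_smul, ← hxy, Ring.lie_def, Ring.lie_def, neg_sub]

theorem lie_spin_cube (hι : ι ^ 2 = -1) (hxy : ⁅x, y⁆ = ι • z) (hyz : ⁅y, z⁆ = ι • x)
    (a c : ℂ) :
    ⁅x, a • y ^ 3 + c • y⁆ = (3 * ι) • (a • (y * z * y) + ((a + c) / 3) • z) := by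
  have hι3 : ι ^ 3 = -ι := by rw [pow_succ, hι, neg_one_mul]
  simp only [Ring.lie_def] at *
  have r1 : y * x = x * y - ι • z := by rw [← hxy]; abel
  have r2 : z * y = y * z - ι • x := by rw [← hyz]; abel
  have r1' : ∀ w, y * (x * w) = x * (y * w) - ι • (z * w) := fun w => by
    rw [← mul_assoc, r1, sub_mul, mul_assoc, smul_mul_assoc]
  have r2' : ∀ w, z * (y * w) = y * (z * w) - ι • (x * w) := fun w => by
    rw [← mul_assoc, r2, sub_mul, mul_assoc, smul_mul_assoc]
  simp only [pow_three, mul_add, add_mul, mul_sub, mul_assoc, smul_sub,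
    smul_add, mul_smul_comm, smul_mul_assoc, smul_smul, r1, r2, r1', r2']
  match_scalars <;> ring_nf
  all_goals (try simp only [hι3]); ring

theorem lie_spin_sandwich (hι : ι ^ 2 = -1) (hxy : ⁅x, y⁆ = ι • z) (hyz : ⁅y, z⁆ = ι • x)
    (hzx : ⁅z, x⁆ = ι • y) (a c : ℂ) :
    ⁅x, a • (y * z * y) + ((a + c) / 3) • z⁆
      = (2 * ι) • (a • (z * y * z) + ((a + c) / 3) • y) - ι • (a • y ^ 3 + c • y) := by
  have hι3 : ι ^ 3 = -ι := by rw [pow_succ, hι, neg_one_mul]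
  simp only [Ring.lie_def] at *
  have r1 : y * x = x * y - ι • z := by rw [← hxy]; abel
  have r2 : z * y = y * z - ι • x := by rw [← hyz]; abel
  have r3 : z * x = x * z + ι • y := by rw [← hzx]; abel
  have r1' : ∀ w, y * (x * w) = x * (y * w) - ι • (z * w) := fun w => by
    rw [← mul_assoc, r1, sub_mul, mul_assoc, smul_mul_assoc]
  have r2' : ∀ w, z * (y * w) = y * (z * w) - ι • (x * w) := fun w => by
    rw [← mul_assoc, r2, sub_mul, mul_assoc, smul_mul_assoc]
  simp only [pow_three, mul_add, add_mul, mul_sub, sub_mul, mul_assoc, smul_sub,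
    smul_add, mul_smul_comm, smul_mul_assoc, smul_smul, r1, r2, r3, r1', r2']
  match_scalars <;> ring_nf
  all_goals (try simp only [hι3]); ring

theorem lie_spin_sandwich_self (hxy : ⁅x, y⁆ = ι • z) (hyz : ⁅y, z⁆ = ι • x)
    (hzx : ⁅z, x⁆ = ι • y) (a c : ℂ) :
    ⁅x, a • (y * x * y) + ((a + c) / 3) • x⁆
      = (2 * ι) • (a • (x * y * z) - (ι * a / 2) • (x ^ 2 - y ^ 2 + z ^ 2)) := by
  simp only [Ring.lie_def] at *
  have r1 : y * x = x * y - ι • z := by rw [← hxy]; abel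
  have r2 : z * y = y * z - ι • x := by rw [← hyz]; abel
  have r3 : z * x = x * z + ι • y := by rw [← hzx]; abel
  have r1' : ∀ w, y * (x * w) = x * (y * w) - ι • (z * w) := fun w => by
    rw [← mul_assoc, r1, sub_mul, mul_assoc, smul_mul_assoc]
  simp only [sq, mul_add, add_mul, mul_sub, sub_mul, mul_assoc, smul_sub,
    smul_add, mul_smul_comm, smul_mul_assoc, smul_smul, r1, r2, r3, r1']
  match_scalars <;> ring

end SpinAlgebra

section CubicTable

/-- The commutation relations of quantized odd monomials `m a b c` with the spin components. -/
structure IsSpinTensor {A : Type*} [Ring A] [Algebra ℂ A] (m : ℕ → ℕ → ℕ → A) : Prop where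
  lie_zero : ∀ a b c, Odd (a + b + c) → ⁅m 1 0 0, m a b c⁆
    = Complex.I • ((b : ℂ) • m a (b - 1) (c + 1) - (c : ℂ) • m a (b + 1) (c - 1))
  lie_one : ∀ a b c, Odd (a + b + c) → ⁅m 0 1 0, m a b c⁆
    = Complex.I • ((c : ℂ) • m (a + 1) b (c - 1) - (a : ℂ) • m (a - 1) b (c + 1))
  lie_two : ∀ a b c, Odd (a + b + c) → ⁅m 0 0 1, m a b c⁆
    = Complex.I • ((a : ℂ) • m (a - 1) (b + 1) c - (b : ℂ) • m (a + 1) (b - 1) c)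

namespace IsSpinTensor

variable {A : Type*} [Ring A] [Algebra ℂ A] {m : ℕ → ℕ → ℕ → A}

theorem lie_zero_one (hm : IsSpinTensor m) : ⁅m 1 0 0, m 0 1 0⁆ = Complex.I • m 0 0 1 := by
  simpa using hm.lie_zero 0 1 0 (by decide)

theorem lie_one_two (hm : IsSpinTensor m) : ⁅m 0 1 0, m 0 0 1⁆ = Complex.I • m 1 0 0 := by
  simpa using hm.lie_one 0 0 1 (by decide)

theorem lie_two_zero (hm : IsSpinTensor m) : ⁅m 0 0 1, m 1 0 0⁆ = Complex.I • m 0 1 0 := by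
  simpa using hm.lie_two 1 0 0 (by decide)

/-- The formula for one cube determines those for all cubic monomials. -/
theorem cubic_formulas (hm : IsSpinTensor m) {a c : ℂ}
    (h : m 0 0 3 = a • m 0 0 1 ^ 3 + c • m 0 0 1) :
    (m 3 0 0 = a • m 1 0 0 ^ 3 + c • m 1 0 0 ∧ m 0 3 0 = a • m 0 1 0 ^ 3 + c • m 0 1 0) ∧
    (m 1 0 2 = a • (m 0 0 1 * m 1 0 0 * m 0 0 1) + ((a + c) / 3) • m 1 0 0 ∧
      m 0 1 2 = a • (m 0 0 1 * m 0 1 0 * m 0 0 1) + ((a + c) / 3) • m 0 1 0 ∧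
      m 2 0 1 = a • (m 1 0 0 * m 0 0 1 * m 1 0 0) + ((a + c) / 3) • m 0 0 1 ∧
      m 0 2 1 = a • (m 0 1 0 * m 0 0 1 * m 0 1 0) + ((a + c) / 3) • m 0 0 1 ∧
      m 2 1 0 = a • (m 1 0 0 * m 0 1 0 * m 1 0 0) + ((a + c) / 3) • m 0 1 0 ∧
      m 1 2 0 = a • (m 0 1 0 * m 1 0 0 * m 0 1 0) + ((a + c) / 3) • m 1 0 0) ∧
    m 1 1 1 = a • (m 1 0 0 * m 0 1 0 * m 0 0 1)
      - (Complex.I * a / 2) • (m 1 0 0 ^ 2 - m 0 1 0 ^ 2 + m 0 0 1 ^ 2) := by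
  have hI := Complex.I_sq
  have hI' : (-Complex.I) ^ 2 = -1 := by rw [neg_sq, hI]
  have xy := hm.lie_zero_one
  have yz := hm.lie_one_two
  have zx := hm.lie_two_zero
  have yx : ⁅m 0 1 0, m 1 0 0⁆ = (-Complex.I) • m 0 0 1 := lie_swap_smul xy
  have zy : ⁅m 0 0 1, m 0 1 0⁆ = (-Complex.I) • m 1 0 0 := lie_swap_smul yz
  have xz : ⁅m 1 0 0, m 0 0 1⁆ = (-Complex.I) • m 0 1 0 := lie_swap_smul zx
  have cancel : ∀ {t : ℂ} {u v : A}, t ≠ 0 → t • u = t • v → u = v := fun ht huv =>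
    smul_right_injective A ht huv
  have h2 : 2 * Complex.I ≠ 0 := by simp
  have h1 : Complex.I ≠ 0 := by simp
  have h3 : 3 * Complex.I ≠ 0 := by simp
  have h3' : 3 * -Complex.I ≠ 0 := by simp
  have h102 : m 1 0 2 = a • (m 0 0 1 * m 1 0 0 * m 0 0 1) + ((a + c) / 3) • m 1 0 0 := by
    refine cancel h3 ?_
    have t := hm.lie_one 0 0 3 (by decide)
    norm_num at t
    rw [← lie_spin_cube hI yz zx, ← h, t]
    module
  have h012 : m 0 1 2 = a • (m 0 0 1 * m 0 1 0 * m 0 0 1) + ((a + c) / 3) • m 0 1 0 := by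
    refine cancel h3' ?_
    have t := hm.lie_zero 0 0 3 (by decide)
    norm_num at t
    rw [← lie_spin_cube hI' xz zy, ← h, t]
    module
  have h201 : m 2 0 1 = a • (m 1 0 0 * m 0 0 1 * m 1 0 0) + ((a + c) / 3) • m 0 0 1 := by
    have t := hm.lie_one 1 0 2 (by decide)
    have l := lie_spin_sandwich hI yz zx xy a c
    norm_num at t
    rw [← h102, ← h, t] at l
    refine cancel h2 ?_
    linear_combination (norm := module) l
  have h021 : m 0 2 1 = a • (m 0 1 0 * m 0 0 1 * m 0 1 0) + ((a + c) / 3) • m 0 0 1 := by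
    have t := hm.lie_zero 0 1 2 (by decide)
    have l := lie_spin_sandwich hI' xz zy yx a c
    norm_num at t
    rw [← h012, ← h, t] at l
    refine cancel h2 ?_
    linear_combination (norm := module) -l
  have h300 : m 3 0 0 = a • m 1 0 0 ^ 3 + c • m 1 0 0 := by
    have t := hm.lie_one 2 0 1 (by decide)
    have l := lie_spin_sandwich hI' yx xz zy a c
    norm_num at t
    rw [← h201, ← h102, t] at l
    refine cancel h1 ?_
    linear_combination (norm := module) l
  have h030 : m 0 3 0 = a • m 0 1 0 ^ 3 + c • m 0 1 0 := by
    have t := hm.lie_zero 0 2 1 (by decide)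
    have l := lie_spin_sandwich hI xy yz zx a c
    norm_num at t
    rw [← h021, ← h012, t] at l
    refine cancel h1 ?_
    linear_combination (norm := module) -l
  have h210 : m 2 1 0 = a • (m 1 0 0 * m 0 1 0 * m 1 0 0) + ((a + c) / 3) • m 0 1 0 := by
    refine cancel h3 ?_
    have t := hm.lie_two 3 0 0 (by decide)
    norm_num at t
    rw [← lie_spin_cube hI zx xy, ← h300, t]
    module
  have h120 : m 1 2 0 = a • (m 0 1 0 * m 1 0 0 * m 0 1 0) + ((a + c) / 3) • m 1 0 0 := by
    refine cancel h3' ?_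
    have t := hm.lie_two 0 3 0 (by decide)
    norm_num at t
    rw [← lie_spin_cube hI' zy yx, ← h030, t]
    module
  refine ⟨⟨h300, h030⟩, ⟨h102, h012, h201, h021, h210, h120⟩, cancel h2 ?_⟩
  have t := hm.lie_zero 1 2 0 (by decide)
  norm_num at t
  rw [← lie_spin_sandwich_self xy yz zx, ← h120, t]
  module

end IsSpinTensor

end CubicTable

section RingBracket

variable {A : Type*} [Ring A]

theorem mul_lie_add (x y z : A) : ⁅x, y + z⁆ = ⁅x, y⁆ + ⁅x, z⁆ := by
  simp only [Ring.lie_def]; noncomm_ring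

theorem mul_lie_sub (x y z : A) : ⁅x, y - z⁆ = ⁅x, y⁆ - ⁅x, z⁆ := by
  simp only [Ring.lie_def]; noncomm_ring

end RingBracket

namespace IsSpinTensor

section Ladder

variable {A : Type*} [Ring A] [Algebra ℂ A] {m : ℕ → ℕ → ℕ → A}

theorem mul_lie_smul (x y : A) (t : ℂ) : ⁅x, t • y⁆ = t • ⁅x, y⁆ := by
  rw [Ring.lie_def, Ring.lie_def, mul_smul_comm, smul_mul_assoc, smul_sub]

theorem lower_lie (x y z : A) (t : ℂ) : ⁅x - t • y, z⁆ = ⁅x, z⁆ - t • ⁅y, z⁆ := by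
  simp only [Ring.lie_def, sub_mul, mul_sub, smul_mul_assoc, mul_smul_comm]; module

theorem raise_commutator (hm : IsSpinTensor m) :
    m 0 0 1 * (m 1 0 0 + Complex.I • m 0 1 0)
      = (m 1 0 0 + Complex.I • m 0 1 0) * m 0 0 1 + (m 1 0 0 + Complex.I • m 0 1 0) := by
  have h1 := hm.lie_one_two
  have h2 := hm.lie_two_zero
  rw [Ring.lie_def] at h1 h2
  simp only [mul_add, add_mul, mul_smul_comm, smul_mul_assoc]
  linear_combination (norm := skip) h2 - Complex.I • h1
  match_scalars <;> ring_nf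
  simp

theorem lower_commutator (hm : IsSpinTensor m) :
    m 0 0 1 * (m 1 0 0 - Complex.I • m 0 1 0)
      = (m 1 0 0 - Complex.I • m 0 1 0) * m 0 0 1 - (m 1 0 0 - Complex.I • m 0 1 0) := by
  have h1 := hm.lie_one_two
  have h2 := hm.lie_two_zero
  rw [Ring.lie_def] at h1 h2
  simp only [mul_sub, sub_mul, mul_smul_comm, smul_mul_assoc]
  linear_combination (norm := skip) h2 + Complex.I • h1
  match_scalars <;> ring_nf
  simp

theorem lower_raise_commutator (hm : IsSpinTensor m) :
    (m 1 0 0 - Complex.I • m 0 1 0) * (m 1 0 0 + Complex.I • m 0 1 0)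
      = (m 1 0 0 + Complex.I • m 0 1 0) * (m 1 0 0 - Complex.I • m 0 1 0) - 2 * m 0 0 1 := by
  have h1 := hm.lie_zero_one
  rw [Ring.lie_def] at h1
  simp only [mul_sub, sub_mul, mul_add, add_mul, mul_smul_comm, smul_mul_assoc, two_mul]
  linear_combination (norm := skip) (2 * Complex.I) • h1
  match_scalars <;> ring_nf
  simp

/-- The quantization of `(S₁ + i S₂)³`. -/
noncomputable def highest (m : ℕ → ℕ → ℕ → A) : A :=
  m 3 0 0 - (3 : ℂ) • m 1 2 0 + Complex.I • ((3 : ℂ) • m 2 1 0 - m 0 3 0)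

theorem weight_highest (hm : IsSpinTensor m) :
    m 0 0 1 * highest m = highest m * m 0 0 1 + ((3 : ℕ) : ℂ) • highest m := by
  have h1 := hm.lie_two 3 0 0 (by decide)
  have h2 := hm.lie_two 1 2 0 (by decide)
  have h3 := hm.lie_two 2 1 0 (by decide)
  have h4 := hm.lie_two 0 3 0 (by decide)
  norm_num [Ring.lie_def] at h1 h2 h3 h4
  simp only [highest, mul_sub, sub_mul, mul_add, add_mul, mul_smul_comm, smul_mul_assoc]
  linear_combination (norm := skip)
    h1 - (3 : ℂ) • h2 + (3 * Complex.I) • h3 - Complex.I • h4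
  match_scalars <;> ring_nf <;> simp

theorem raise_commute_highest (hm : IsSpinTensor m) :
    (m 1 0 0 + Complex.I • m 0 1 0) * highest m
      = highest m * (m 1 0 0 + Complex.I • m 0 1 0) := by
  have h1 := hm.lie_zero 3 0 0 (by decide)
  have h2 := hm.lie_zero 1 2 0 (by decide)
  have h3 := hm.lie_zero 2 1 0 (by decide)
  have h4 := hm.lie_zero 0 3 0 (by decide)
  have k1 := hm.lie_one 3 0 0 (by decide)
  have k2 := hm.lie_one 1 2 0 (by decide)
  have k3 := hm.lie_one 2 1 0 (by decide)
  have k4 := hm.lie_one 0 3 0 (by decide)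
  norm_num [Ring.lie_def] at h1 h2 h3 h4 k1 k2 k3 k4
  simp only [highest, mul_sub, sub_mul, mul_add, add_mul, mul_smul_comm, smul_mul_assoc]
  linear_combination (norm := skip)
    h1 - (3 : ℂ) • h2 + (3 * Complex.I) • h3 - Complex.I • h4
    + Complex.I • (k1 - (3 : ℂ) • k2 + (3 * Complex.I) • k3 - Complex.I • k4)
  match_scalars <;> ring_nf
  all_goals simp

theorem lower_three_highest (hm : IsSpinTensor m) :
    ⁅m 1 0 0 - Complex.I • m 0 1 0, ⁅m 1 0 0 - Complex.I • m 0 1 0,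
      ⁅m 1 0 0 - Complex.I • m 0 1 0, highest m⁆⁆⁆
      = (-48 : ℂ) • m 0 0 3 + (72 : ℂ) • (m 2 0 1 + m 0 2 1) := by
  have e1 : ⁅m 1 0 0 - Complex.I • m 0 1 0, highest m⁆
      = (-6 : ℂ) • (m 2 0 1 - m 0 2 1 + (2 * Complex.I) • m 1 1 1) := by
    simp only [highest, mul_lie_sub, mul_lie_add, mul_lie_smul, lower_lie]
    rw [hm.lie_zero 3 0 0 (by decide), hm.lie_zero 1 2 0 (by decide),
      hm.lie_zero 2 1 0 (by decide), hm.lie_zero 0 3 0 (by decide),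
      hm.lie_one 3 0 0 (by decide), hm.lie_one 1 2 0 (by decide),
      hm.lie_one 2 1 0 (by decide), hm.lie_one 0 3 0 (by decide)]
    norm_num
    match_scalars <;> ring_nf
    all_goals simp
    all_goals ring
  have e2 : ⁅m 1 0 0 - Complex.I • m 0 1 0, m 2 0 1 - m 0 2 1 + (2 * Complex.I) • m 1 1 1⁆
      = m 3 0 0 + m 1 2 0 - (4 : ℂ) • m 1 0 2
        + Complex.I • (m 2 1 0 + m 0 3 0 - (4 : ℂ) • m 0 1 2) := by
    simp only [mul_lie_sub, mul_lie_add, mul_lie_smul, lower_lie]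
    rw [hm.lie_zero 2 0 1 (by decide), hm.lie_zero 0 2 1 (by decide),
      hm.lie_zero 1 1 1 (by decide), hm.lie_one 2 0 1 (by decide),
      hm.lie_one 0 2 1 (by decide), hm.lie_one 1 1 1 (by decide)]
    norm_num
    match_scalars <;> ring_nf <;> simp <;> ring
  rw [e1, mul_lie_smul, e2]
  simp only [mul_lie_sub, mul_lie_add, mul_lie_smul, lower_lie]
  rw [hm.lie_zero 3 0 0 (by decide), hm.lie_zero 1 2 0 (by decide),
    hm.lie_zero 2 1 0 (by decide), hm.lie_zero 0 3 0 (by decide),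
    hm.lie_zero 1 0 2 (by decide), hm.lie_zero 0 1 2 (by decide),
    hm.lie_one 3 0 0 (by decide), hm.lie_one 1 2 0 (by decide),
    hm.lie_one 2 1 0 (by decide), hm.lie_one 0 3 0 (by decide),
    hm.lie_one 1 0 2 (by decide), hm.lie_one 0 1 2 (by decide)]
  norm_num
  match_scalars <;> ring_nf <;> simp

end Ladder

section Hilbert

variable {H : Type*} [NormedAddCommGroup H] [InnerProductSpace ℂ H] {m : ℕ → ℕ → ℕ → (H →L[ℂ] H)}

theorem exists_cube_formula [Nontrivial H] (hm : IsSpinTensor m) {r : ℂ}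
    (hr : m 2 0 1 + m 0 2 1 + m 0 0 3 = r • m 0 0 1)
    (hirr : ∀ W : Submodule ℂ H, IsClosed (W : Set H) → (∀ x ∈ W, m 1 0 0 x ∈ W) →
      (∀ x ∈ W, m 0 1 0 x ∈ W) → (∀ x ∈ W, m 0 0 1 x ∈ W) → W = ⊥ ∨ W = ⊤) :
    ∃ a c : ℂ, m 0 0 3 = a • m 0 0 1 ^ 3 + c • m 0 0 1 := by
  have he := hm.raise_commutator
  have hf := hm.lower_commutator
  have hef := hm.lower_raise_commutator
  have hirr' : ∀ W : Submodule ℂ H, IsClosed (W : Set H) → (∀ x ∈ W, m 0 0 1 x ∈ W) →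
      (∀ x ∈ W, (m 1 0 0 + Complex.I • m 0 1 0) x ∈ W) →
      (∀ x ∈ W, (m 1 0 0 - Complex.I • m 0 1 0) x ∈ W) → W = ⊥ ∨ W = ⊤ := by
    intro W hW h1 h2 h3
    refine hirr W hW (fun x hx => ?_) (fun x hx => ?_) h1
    · have e : m 1 0 0 x = (1 / 2 : ℂ) • ((m 1 0 0 + Complex.I • m 0 1 0) x
          + (m 1 0 0 - Complex.I • m 0 1 0) x) := by
        simp only [add_apply, sub_apply, smul_apply]; module
      rw [e]
      exact W.smul_mem _ (W.add_mem (h2 x hx) (h3 x hx))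
    · have e : m 0 1 0 x = (-Complex.I / 2 : ℂ) • ((m 1 0 0 + Complex.I • m 0 1 0) x
          - (m 1 0 0 - Complex.I • m 0 1 0) x) := by
        simp only [add_apply, sub_apply, smul_apply]
        match_scalars <;> ring_nf
        simp
      rw [e]
      exact W.smul_mem _ (W.sub_mem (h2 x hx) (h3 x hx))
  obtain ⟨a, ha⟩ := exists_eq_smul_pow_of_irreducible he hf hef hirr' hm.weight_highest
    hm.raise_commute_highest
  obtain ⟨κ, hκ⟩ := exists_casimir_of_irreducible he hf hef hirr'
  have key := hm.lower_three_highest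
  rw [ha, mul_lie_smul, mul_lie_smul, mul_lie_smul, lower_three_raise_pow_three he hf hef hκ] at key
  refine ⟨a, 3 / 5 * r - a * ((72 * κ - 24) / 120), ?_⟩
  linear_combination (norm := module) (1 / 120 : ℂ) • key + (72 / 120 : ℂ) • hr

end Hilbert

end IsSpinTensor

theorem exists_real_coefficients {A : Type*} [Ring A] [StarRing A] [Algebra ℂ A] [StarModule ℂ A]
    {x y : A} (hx : IsSelfAdjoint x) (hy : IsSelfAdjoint y) {a c : ℂ} {n : ℕ}
    (h : y = a • x ^ n + c • x) : y = (a.re : ℂ) • x ^ n + (c.re : ℂ) • x := by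
  have h' := congrArg star h
  rw [hy.star_eq, star_add, star_smul, star_smul, (hx.pow n).star_eq, hx.star_eq] at h'
  have e : ∀ z : ℂ, (z.re : ℂ) = (z + star z) / 2 := fun z => Complex.re_eq_add_conj z
  rw [e, e]
  linear_combination (norm := module) (1 / 2 : ℂ) • h + (1 / 2 : ℂ) • h'

theorem isSpinTensor_of_lie {A : Type*} [Ring A] [Algebra ℂ A] (q : Poly →ₗ[ℝ] A)
    (hq : ∀ f ∈ oddPoly, ∀ g ∈ oddPoly, ⁅q f, q g⁆ = Complex.I • q (polyBracket f g)) :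
    IsSpinTensor fun a b c => q (spinMonomial a b c) := by
  have hX : spinMonomial 1 0 0 = X 0 ∧ spinMonomial 0 1 0 = X 1 ∧ spinMonomial 0 0 1 = X 2 := by
    simp [spinMonomial]
  obtain ⟨h0, h1, h2⟩ := hX
  refine ⟨fun a b c h => ?_, fun a b c h => ?_, fun a b c h => ?_⟩
  · rw [h0, hq _ (X_mem_oddPoly 0) _ (spinMonomial_mem_oddPoly h), polyBracket_X_zero, map_sub,
      map_smul, map_smul, Nat.cast_smul_eq_nsmul, Nat.cast_smul_eq_nsmul,
      Nat.cast_smul_eq_nsmul, Nat.cast_smul_eq_nsmul]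
  · rw [h1, hq _ (X_mem_oddPoly 1) _ (spinMonomial_mem_oddPoly h), polyBracket_X_one, map_sub,
      map_smul, map_smul, Nat.cast_smul_eq_nsmul, Nat.cast_smul_eq_nsmul,
      Nat.cast_smul_eq_nsmul, Nat.cast_smul_eq_nsmul]
  · rw [h2, hq _ (X_mem_oddPoly 2) _ (spinMonomial_mem_oddPoly h), polyBracket_X_two, map_sub,
      map_smul, map_smul, Nat.cast_smul_eq_nsmul, Nat.cast_smul_eq_nsmul,
      Nat.cast_smul_eq_nsmul, Nat.cast_smul_eq_nsmul]

theorem sphere_relation {s : ℝ} {A : Type*} [Ring A] [Algebra ℂ A] (q : Poly →ₗ[ℝ] A)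
    (hq : ∀ f ∈ sphereIdeal s, q f = 0) :
    q (spinMonomial 2 0 1) + q (spinMonomial 0 2 1) + q (spinMonomial 0 0 3)
      = ((s ^ 2 : ℝ) : ℂ) • q (spinMonomial 0 0 1) := by
  have h := hq (X 2 * (X 0 ^ 2 + X 1 ^ 2 + X 2 ^ 2 - C (s ^ 2)))
    (Ideal.mul_mem_left _ _ (Ideal.subset_span rfl))
  have e : X 2 * (X 0 ^ 2 + X 1 ^ 2 + X 2 ^ 2 - C (s ^ 2)) = spinMonomial 2 0 1
      + spinMonomial 0 2 1 + spinMonomial 0 0 3 - (s ^ 2) • spinMonomial 0 0 1 := by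
    simp only [spinMonomial, smul_eq_C_mul]; ring
  rw [e, map_sub, map_smul, sub_eq_zero, map_add, map_add] at h
  rw [h, Complex.coe_smul]

/-- Irreducibility on `𝒫¹` is irreducibility under the three spin components. -/
theorem IsAdmissibleQuantization.eq_bot_or_eq_top {s : ℝ} {H : Type*} [NormedAddCommGroup H]
    [InnerProductSpace ℂ H] [CompleteSpace H] {Q : (oddPlusConst s).toSubmodule →ₗ[ℝ] (H →L[ℂ] H)}
    (hQ : IsAdmissibleQuantization (oddPlusConst s) (degreeLEOne s) (degreeLEOne_le s) Q)
    {W : Submodule ℂ H} (hW : IsClosed (W : Set H))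
    (h : ∀ i, ∀ x ∈ W, Q ⟨spin s i, spin_mem s i⟩ x ∈ W) : W = ⊥ ∨ W = ⊤ := by
  refine hQ.irreducible.2 W hW ?_
  rintro _ ⟨⟨_, f, hf, rfl⟩, rfl⟩ x hx
  have hf' := eq_of_totalDegree_le_one ((mem_restrictTotalDegree _ _ _).1 hf)
  have h1 : (1 : SpherePoly s) ∈ (oddPlusConst s).toSubmodule :=
    (mem_oddPlusConst_iff s 1).2 ⟨0, zero_mem _, 1, by rw [zero_add, C_1]; rfl⟩
  have e : (⟨toSphere s f, degreeLEOne_le s ⟨f, hf, rfl⟩⟩ : (oddPlusConst s).toSubmodule)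
      = ∑ i, coeff (Finsupp.single i 1) f • ⟨spin s i, spin_mem s i⟩ + coeff 0 f • ⟨1, h1⟩ := by
    apply Subtype.ext
    simp only [Submodule.coe_add, Submodule.coe_sum, Submodule.coe_smul]
    conv_lhs => rw [hf']
    rw [map_add, map_sum]
    congr 1
    rw [show (C (coeff 0 f) : Poly) = coeff 0 f • 1 by rw [smul_eq_C_mul, mul_one], map_smul]
    rfl
  change Q ⟨toSphere s f, degreeLEOne_le s ⟨f, hf, rfl⟩⟩ x ∈ W
  rw [e, map_add, map_sum, map_smul, hQ.one h1, add_apply, sum_apply]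
  refine W.add_mem (W.sum_mem fun i _ => ?_) ?_
  · rw [map_smul, smul_apply, ← Complex.coe_smul]
    exact W.smul_mem _ (h i x hx)
  · rw [smul_apply, ← Complex.coe_smul]
    exact W.smul_mem _ hx

end SpinSphere

open SpinSphere in
theorem proposition4 (s : ℝ) (hs : 0 < s)
    {H : Type*} [NormedAddCommGroup H] [InnerProductSpace ℂ H] [CompleteSpace H]
    (Q : (oddPlusConst s).toSubmodule →ₗ[ℝ] (H →L[ℂ] H))
    (hQ : IsAdmissibleQuantization (oddPlusConst s) (degreeLEOne s) (degreeLEOne_le s) Q) :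
    ∃ a c : ℝ,
      (∀ i : Fin 3,
        Q ⟨spin s i ^ 3, spin_pow_three_mem s i⟩
          = a • Q ⟨spin s i, spin_mem s i⟩ ^ 3 + c • Q ⟨spin s i, spin_mem s i⟩) ∧
      (∀ i l : Fin 3, i ≠ l →
        Q ⟨spin s i * spin s l * spin s i, spin_mul_mem s i l i⟩
          = a • (Q ⟨spin s i, spin_mem s i⟩ * Q ⟨spin s l, spin_mem s l⟩
              * Q ⟨spin s i, spin_mem s i⟩)
            + ((1 / 3 : ℝ) * (a + c)) • Q ⟨spin s l, spin_mem s l⟩) ∧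
      Q ⟨spin s 0 * spin s 1 * spin s 2, spin_mul_mem s 0 1 2⟩
        = a • (Q ⟨spin s 0, spin_mem s 0⟩ * Q ⟨spin s 1, spin_mem s 1⟩
            * Q ⟨spin s 2, spin_mem s 2⟩)
          + ((a : ℂ) / (2 * Complex.I)) • (Q ⟨spin s 0, spin_mem s 0⟩ ^ 2
            - Q ⟨spin s 1, spin_mem s 1⟩ ^ 2 + Q ⟨spin s 2, spin_mem s 2⟩ ^ 2) := by
  obtain ⟨q, hqQ, hq0, hqb⟩ := IsQuantization.exists_linear_lift Q hQ.toIsQuantization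
  have hm := isSpinTensor_of_lie q hqb
  have hr := sphere_relation q hq0
  have hnt : Nontrivial H := hQ.irreducible.1
  have hsp : ∀ i, q (MvPolynomial.X i) = Q ⟨spin s i, spin_mem s i⟩ :=
    fun i => hqQ (MvPolynomial.X i) (spin_mem s i)
  have hX : spinMonomial 1 0 0 = MvPolynomial.X 0 ∧ spinMonomial 0 1 0 = MvPolynomial.X 1 ∧
      spinMonomial 0 0 1 = MvPolynomial.X 2 := by simp [spinMonomial]
  have h0 : q (spinMonomial 1 0 0) = Q ⟨spin s 0, spin_mem s 0⟩ := by rw [hX.1, hsp]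
  have h1 : q (spinMonomial 0 1 0) = Q ⟨spin s 1, spin_mem s 1⟩ := by rw [hX.2.1, hsp]
  have h2 : q (spinMonomial 0 0 1) = Q ⟨spin s 2, spin_mem s 2⟩ := by rw [hX.2.2, hsp]
  have hmul : ∀ (i j k : Fin 3) (a b c : ℕ),
      spinMonomial a b c = MvPolynomial.X i * MvPolynomial.X j * MvPolynomial.X k →
      Q ⟨spin s i * spin s j * spin s k, spin_mul_mem s i j k⟩ = q (spinMonomial a b c) := by
    intro i j k a b c h
    rw [h]
    exact (hqQ (MvPolynomial.X i * MvPolynomial.X j * MvPolynomial.X k)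
      (spin_mul_mem s i j k)).symm
  have hcube : ∀ i : Fin 3, Q ⟨spin s i ^ 3, spin_pow_three_mem s i⟩
      = q (MvPolynomial.X i ^ 3) :=
    fun i => (hqQ (MvPolynomial.X i ^ 3) (spin_pow_three_mem s i)).symm
  have hirr : ∀ W : Submodule ℂ H, IsClosed (W : Set H) →
      (∀ x ∈ W, q (spinMonomial 1 0 0) x ∈ W) → (∀ x ∈ W, q (spinMonomial 0 1 0) x ∈ W) →
      (∀ x ∈ W, q (spinMonomial 0 0 1) x ∈ W) → W = ⊥ ∨ W = ⊤ := by
    intro W hW i0 i1 i2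
    rw [h0] at i0
    rw [h1] at i1
    rw [h2] at i2
    refine hQ.eq_bot_or_eq_top hW fun i => ?_
    fin_cases i
    exacts [i0, i1, i2]
  obtain ⟨a', c', hac⟩ := hm.exists_cube_formula hr hirr
  have hsa : IsSelfAdjoint (q (spinMonomial 0 0 3)) := by
    have : spinMonomial 0 0 3 = MvPolynomial.X 2 ^ 3 := by simp [spinMonomial]
    rw [this, ← hcube]
    exact hQ.selfAdjoint _
  have hac' := exists_real_coefficients (by rw [h2]; exact hQ.selfAdjoint _) hsa hac
  obtain ⟨⟨c0, c1⟩, ⟨h02, h12, h20, h21, h01, h10⟩, h012⟩ := hm.cubic_formulas hac'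
  have c2 := hac'
  have hcoe : ((1 / 3 : ℝ) * (a'.re + c'.re) : ℝ) = ((a'.re : ℂ) + c'.re) / 3 := by
    push_cast; ring
  have hIa : (a'.re : ℂ) / (2 * Complex.I) = -(Complex.I * a'.re / 2) := by
    rw [div_eq_iff (by simp)]
    linear_combination (a'.re : ℂ) * Complex.I_sq
  simp only [h0, h1, h2] at c0 c1 c2 h02 h12 h20 h21 h01 h10 h012
  refine ⟨a'.re, c'.re, ?_, ?_, ?_⟩
  · intro i
    rw [hcube, ← Complex.coe_smul a'.re, ← Complex.coe_smul c'.re]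
    fin_cases i
    · exact (congrArg q (by simp [spinMonomial] : _ = spinMonomial 3 0 0)).trans c0
    · exact (congrArg q (by simp [spinMonomial] : _ = spinMonomial 0 3 0)).trans c1
    · exact (congrArg q (by simp [spinMonomial] : _ = spinMonomial 0 0 3)).trans c2
  · intro i l hil
    rw [← Complex.coe_smul a'.re, ← Complex.coe_smul ((1 / 3 : ℝ) * _), hcoe]
    fin_cases i <;> fin_cases l
    · exact absurd rfl hil
    · exact (hmul 0 1 0 2 1 0 (by simp only [spinMonomial]; ring)).trans h01
    · exact (hmul 0 2 0 2 0 1 (by simp only [spinMonomial]; ring)).trans h20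
    · exact (hmul 1 0 1 1 2 0 (by simp only [spinMonomial]; ring)).trans h10
    · exact absurd rfl hil
    · exact (hmul 1 2 1 0 2 1 (by simp only [spinMonomial]; ring)).trans h21
    · exact (hmul 2 0 2 1 0 2 (by simp only [spinMonomial]; ring)).trans h02
    · exact (hmul 2 1 2 0 1 2 (by simp only [spinMonomial]; ring)).trans h12
    · exact absurd rfl hil
  · rw [← Complex.coe_smul a'.re, hIa, neg_smul, ← sub_eq_add_neg,
      hmul 0 1 2 1 1 1 (by simp only [spinMonomial]; ring), h012]
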